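/- Let $m,n,q$ be nonnegative integers with $m+q\neq n$, and let $A\in\mathbb{C}^{m\times n}$ and $C\in\mathbb{C}^{q\times n}$ be random matrices all of whose entries are jointly independent circularly symmetric complex Gaussian random variables with zero mean and unit variance (real and imaginary parts independent, each $N(0,1/2)$). Write $M^H$ for the conjugate transpose of $M$, and put $B=\begin{pmatrix}A\\ C\end{pmatrix}$, $k=\operatorname{rank}B$, $r=\operatorname{rank}B-\operatorname{rank}C$ and $s=\operatorname{rank}A+\operatorname{rank}C-\operatorname{rank}B$. A generalized singular value decomposition (GSVD) of $(A,C)$ consists of unitary matrices $U\in\mathbb{C}^{m\times m}$, $V\in\mathbb{C}^{q\times q}$ and a matrix $Q\in\mathbb{C}^{n\times n}$ with $$UAQ=(\Sigma_A,\,O),\qquad VCQ=(\Sigma_C,\,O),$$ $$\Sigma_A=\begin{pmatrix}I_r&&\\&S_A&\\&&O_A\end{pmatrix}\in\mathbb{C}^{m\times k},\qquad \Sigma_C=\begin{pmatrix}O_C&&\\&S_C&\\&&I_{k-r-s}\end{pmatrix}\in\mathbb{C}^{q\times k},$$ where $S_A=\operatorname{diag}(\alpha_1,\dots,\alpha_s)$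 and $S_C=\operatorname{diag}(\beta_1,\dots,\beta_s)$ with $\alpha_i,\beta_i\ge 0$ and $\alpha_i^2+\beta_i^2=1$, where $O$, $O_A$, $O_C$ are zero matrices, and where $Q$ has the form $$Q=Q'\begin{pmatrix}(W^HR)^{-1}&\\&O_{n-k}\end{pmatrix}$$ with $Q'\in\mathbb{C}^{n\times n}$ and $W\in\mathbb{C}^{k\times k}$ unitary and $R\in\mathbb{C}^{k\times k}$ a nonnegative diagonal matrix whose singular values are the nonzero singular values of $B$, counted with multiplicity. Then almost surely $(A,C)$ has a GSVD, and for every choice of a GSVD (almost surely) of $(A,C)$, the random variable $\operatorname{trace}(QQ^H)$ is integrable and $$\mathbb{E}\left[\operatorname{trace}(QQ^H)\right]=\frac{\min\{m+q,\,n\}}{|m+q-n|}.$$ -/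

import Mathlib

open scoped Matrix

noncomputable section

namespace GSVD

/-- The circularly symmetric complex Gaussian law with mean zero and unit variance: the real and
imaginary parts are independent real Gaussians with mean `0` and variance `1/2`. -/
def stdComplexGaussian : MeasureTheory.Measure ℂ :=
  ((ProbabilityTheory.gaussianReal 0 (1 / 2)).prod (ProbabilityTheory.gaussianReal 0 (1 / 2))).map
    (fun p : ℝ × ℝ => (⟨p.1, p.2⟩ : ℂ))

/-- The `m × n` matrix `(M, O)` obtained from the `m × k` matrix `M` by appending zero columns
(meant for `k ≤ n`). -/
def padCols {m k : ℕ} (n : ℕ) (M : Matrix (Fin m) (Fin k) ℂ) : Matrix (Fin m) (Fin n) ℂ :=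
  Matrix.of fun i j => if h : j.1 < k then M i ⟨j.1, h⟩ else 0

/-- The `n × n` block diagonal matrix `diag(M, O)` with the `k × k` matrix `M` as upper left block
and zeros elsewhere (meant for `k ≤ n`). -/
def padSquare {k : ℕ} (n : ℕ) (M : Matrix (Fin k) (Fin k) ℂ) : Matrix (Fin n) (Fin n) ℂ :=
  Matrix.of fun i j => if h : i.1 < k ∧ j.1 < k then M ⟨i.1, h.1⟩ ⟨j.1, h.2⟩ else 0

/-- The `m × k` block diagonal matrix `diag(I_r, S_A, O_A)`, where `S_A = diag(α_1, …, α_s)` and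
`O_A` is the zero matrix of size `(m - r - s) × (k - r - s)`. -/
def sigmaA (m k r s : ℕ) (α : Fin s → ℝ) : Matrix (Fin m) (Fin k) ℂ :=
  Matrix.of fun i j =>
    if i.1 = j.1 then
      if j.1 < r then 1
      else if h : j.1 - r < s then ((α ⟨j.1 - r, h⟩ : ℝ) : ℂ)
      else 0
    else 0

/-- The `q × k` block diagonal matrix `diag(O_C, S_C, I_{k-r-s})`, where `S_C = diag(β_1, …, β_s)`
and `O_C` is the zero matrix of size `(q - (k - r)) × r`. Hence column `j ≥ r` has its only nonzero
entry in row `i = q - k + j`, and the columns `j < r` vanish. -/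
def sigmaC (q k r s : ℕ) (β : Fin s → ℝ) : Matrix (Fin q) (Fin k) ℂ :=
  Matrix.of fun i j =>
    if r ≤ j.1 ∧ i.1 + k = q + j.1 then
      if h : j.1 - r < s then ((β ⟨j.1 - r, h⟩ : ℝ) : ℂ)
      else 1
    else 0

/-- `(U, V, Q)` with the generalized cosines `α` and sines `β` is a generalized singular value
decomposition of the pair `(A, C)`, with
`k = rank B`, `r = rank B - rank C`, `s = rank A + rank C - rank B`, where `B` is `A` on top of `C`
(so `k ≤ n`, and neither of the two differences is negative). -/
structure IsGSVD {m n q : ℕ} (A : Matrix (Fin m) (Fin n) ℂ) (C : Matrix (Fin q) (Fin n) ℂ)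
    (k r s : ℕ) (U : Matrix (Fin m) (Fin m) ℂ) (V : Matrix (Fin q) (Fin q) ℂ)
    (Q : Matrix (Fin n) (Fin n) ℂ) (α β : Fin s → ℝ) : Prop where
  k_eq : k = (Matrix.fromRows A C).rank
  r_eq : r = (Matrix.fromRows A C).rank - C.rank
  s_eq : s = A.rank + C.rank - (Matrix.fromRows A C).rank
  unitary_U : U ∈ Matrix.unitaryGroup (Fin m) ℂ
  unitary_V : V ∈ Matrix.unitaryGroup (Fin q) ℂ
  α_nonneg : ∀ i, 0 ≤ α i
  β_nonneg : ∀ i, 0 ≤ β i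
  sq_add_sq : ∀ i, α i ^ 2 + β i ^ 2 = 1
  decomp_A : U * A * Q = padCols n (sigmaA m k r s α)
  decomp_C : V * C * Q = padCols n (sigmaC q k r s β)
  /-- `Q = Q' diag((Wᴴ R)⁻¹, O)` with `Q'` and `W` unitary and `R` a nonnegative `k × k` diagonal
  matrix whose singular values are the nonzero singular values of `B`. (Mathlib lists the
  singular values in descending order, with multiplicity, followed by zeros.) -/
  form_Q : ∃ Q' ∈ Matrix.unitaryGroup (Fin n) ℂ, ∃ W ∈ Matrix.unitaryGroup (Fin k) ℂ,
    ∃ ρ : Fin k → ℝ, (∀ i, 0 ≤ ρ i) ∧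
      (Matrix.toEuclideanLin (Matrix.diagonal fun i => ((ρ i : ℝ) : ℂ))).singularValues =
        (Matrix.toEuclideanLin (Matrix.fromRows A C)).singularValues ∧
      Q = Q' * padSquare n ((Wᴴ * Matrix.diagonal fun i => ((ρ i : ℝ) : ℂ))⁻¹)

/-- `Q` is the decomposition matrix `Q` of some generalized singular value decomposition
of the pair `(A, C)`. -/
def IsGSVDFactor {m n q : ℕ} (A : Matrix (Fin m) (Fin n) ℂ) (C : Matrix (Fin q) (Fin n) ℂ)
    (Q : Matrix (Fin n) (Fin n) ℂ) : Prop :=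
  ∃ (k r s : ℕ) (U : Matrix (Fin m) (Fin m) ℂ) (V : Matrix (Fin q) (Fin q) ℂ) (α β : Fin s → ℝ),
    IsGSVD A C k r s U V Q α β

end GSVD

end

noncomputable section

namespace GSVD

/-! The trace of `Q * Qᴴ` does not depend on the GSVD chosen. The unitary factors `Q'` and `W`
cancel, and what remains is the sum of `ρ_i⁻²` over the nonzero singular values of `B`, that is, the
sum `invTrace (Bᴴ * B)` of the inverse nonzero eigenvalues of `Bᴴ * B`
(`trace_mul_conjTranspose_of_isGSVDFactor`). The statement thus becomes an inverse moment of a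
complex Wishart matrix.

Let `X` be Gaussian with `N` rows and `p < N` columns. The columns are almost surely independent, so
the sum is the trace of the inverse Gram matrix. Its `j`-th diagonal entry is the inverse squared
distance of column `j` from the span of the others (`inv_gram_insertNth_apply`). Given the other
columns, this distance is the norm of a standard complex Gaussian vector in dimension `N - p + 1`,
whose inverse square has mean `1 / (N - p)`; adding `p` such entries gives `p / (N - p)`. If `B` has
fewer rows than columns, `invTrace (M * N) = invTrace (N * M)` reduces the claim to the transpose.

Existence of a GSVD is deterministic: a singular value decomposition of `B` leaves two blocks with
jointly orthonormal columns, and these have a CS decomposition (`exists_cs_decomposition`). -/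

/-- The sum of the inverses of the nonzero eigenvalues of a square matrix, with multiplicity. -/
def invTrace {ι : Type*} [Fintype ι] [DecidableEq ι] (H : Matrix ι ι ℂ) : ℂ :=
  (H.charpoly.roots.map (fun z => z⁻¹)).sum

/-! ### Sums of inverse nonzero eigenvalues -/

section invTrace

variable {ι κ : Type*} [Fintype ι] [DecidableEq ι] [Fintype κ] [DecidableEq κ]

/-- The extra roots are zeros, and `0⁻¹ = 0`. -/
lemma sum_inv_roots_X_pow_mul_charpoly (k : ℕ) (M : Matrix ι ι ℂ) :
    (((Polynomial.X ^ k * M.charpoly).roots).map (fun z : ℂ => z⁻¹)).sum = invTrace M := by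
  rw [Polynomial.roots_mul (mul_ne_zero (pow_ne_zero _ Polynomial.X_ne_zero)
    M.charpoly_monic.ne_zero)]
  simp [invTrace, Multiset.map_nsmul, Multiset.sum_nsmul]

/-- The two characteristic polynomials agree up to powers of `X`. -/
lemma invTrace_mul_comm (A : Matrix ι κ ℂ) (B : Matrix κ ι ℂ) :
    invTrace (A * B) = invTrace (B * A) := by
  rw [← sum_inv_roots_X_pow_mul_charpoly (Fintype.card κ), A.charpoly_mul_comm' B,
    sum_inv_roots_X_pow_mul_charpoly]

lemma invTrace_diagonal (d : ι → ℂ) :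
    invTrace (Matrix.diagonal d) = ∑ i, (d i)⁻¹ := by
  rw [invTrace, Matrix.charpoly_diagonal, Polynomial.roots_prod _ _
    (by simp [Finset.prod_ne_zero_iff, Polynomial.X_sub_C_ne_zero])]
  simp

lemma invTrace_transpose (H : Matrix ι ι ℂ) : invTrace Hᵀ = invTrace H := by
  rw [invTrace, invTrace, Matrix.charpoly_transpose]

end invTrace

/-! ### Singular values and unitary diagonalization -/

/-- The singular values of a complex matrix. -/
abbrev sv {ι κ : Type*} [Fintype ι] [Fintype κ] [DecidableEq κ] (M : Matrix ι κ ℂ) : ℕ →₀ ℝ :=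
  (Matrix.toEuclideanLin M).singularValues

lemma mem_unitaryGroup_of_orthonormalBasis {ι : Type*} [Fintype ι] [DecidableEq ι]
    (b : OrthonormalBasis ι ℂ (EuclideanSpace ℂ ι)) :
    (Matrix.of fun i j => b j i) ∈ Matrix.unitaryGroup ι ℂ := by
  rw [Matrix.mem_unitaryGroup_iff']
  ext i j
  have := orthonormal_iff_ite.mp b.orthonormal i j
  rw [PiLp.inner_apply] at this
  simp only [Matrix.star_eq_conjTranspose, Matrix.mul_apply, Matrix.conjTranspose_apply,
    Matrix.of_apply, Matrix.one_apply, ← this]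
  refine Finset.sum_congr rfl fun k _ => ?_
  simp [mul_comm]

/-- The columns of `W` are an eigenbasis of the self-adjoint `Mᴴ * M`. The diagonal is in descending
order, which the CS decomposition relies on. -/
lemma exists_unitary_conj_eq_diagonal {ι : Type*} [Fintype ι] {n : ℕ}
    (M : Matrix ι (Fin n) ℂ) :
    ∃ W ∈ Matrix.unitaryGroup (Fin n) ℂ,
      Wᴴ * (Mᴴ * M) * W = Matrix.diagonal fun i : Fin n => ((sv M i : ℝ) : ℂ) ^ 2 := by
  classical
  have hn : Module.finrank ℂ (EuclideanSpace ℂ (Fin n)) = n := by simp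
  set T := Matrix.toEuclideanLin M with hT
  have hs := T.isSymmetric_adjoint_comp_self
  set b := hs.eigenvectorBasis hn
  have hW := mem_unitaryGroup_of_orthonormalBasis b
  refine ⟨_, hW, ?_⟩
  set W : Matrix (Fin n) (Fin n) ℂ := Matrix.of fun i j => b j i with hWdef
  have h1 : (Mᴴ * M) * W = W * Matrix.diagonal fun i : Fin n => ((sv M i : ℝ) : ℂ) ^ 2 := by
    ext i j
    have h2 := hs.apply_eigenvectorBasis hn j
    have h3 : (LinearMap.adjoint T ∘ₗ T) = Matrix.toEuclideanLin (Mᴴ * M) := by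
      rw [hT, ← Matrix.toEuclideanLin_conjTranspose_eq_adjoint]
      ext x i
      simp [Matrix.toLpLin_apply]
    have h2 := (LinearMap.congr_fun h3 (b j)).symm.trans h2
    have h4 := congrArg (fun x : EuclideanSpace ℂ (Fin n) => x i) h2
    rw [← T.sq_singularValues_fin hn] at h4
    simp only [Matrix.toLpLin_apply, PiLp.smul_apply, smul_eq_mul] at h4
    rw [Matrix.mul_diagonal, hWdef, Matrix.mul_apply]
    simp only [Matrix.of_apply]
    rw [mul_comm]
    simpa [Matrix.mulVec, dotProduct] using h4
  rw [Matrix.mul_assoc, h1, ← Matrix.mul_assoc]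
  have : Wᴴ * W = 1 := Matrix.mem_unitaryGroup_iff'.mp hW
  rw [this, Matrix.one_mul]

section conj
variable {n : ℕ} {W H : Matrix (Fin n) (Fin n) ℂ} {d : Fin n → ℂ}

lemma eq_of_conj_eq_diagonal (hW : W ∈ Matrix.unitaryGroup (Fin n) ℂ)
    (h : Wᴴ * H * W = Matrix.diagonal d) : H = W * Matrix.diagonal d * Wᴴ := by
  have h1 : W * Wᴴ = 1 := Matrix.mem_unitaryGroup_iff.mp hW
  rw [← h]
  calc H = (W * Wᴴ) * H * (W * Wᴴ) := by simp [h1]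
    _ = _ := by simp only [Matrix.mul_assoc]

lemma charpoly_eq_of_conj_eq_diagonal (hW : W ∈ Matrix.unitaryGroup (Fin n) ℂ)
    (h : Wᴴ * H * W = Matrix.diagonal d) : H.charpoly = (Matrix.diagonal d).charpoly := by
  have h1 : W * Wᴴ = 1 := Matrix.mem_unitaryGroup_iff.mp hW
  rw [← h, Matrix.mul_assoc, Matrix.charpoly_mul_comm, Matrix.mul_assoc, h1, Matrix.mul_one]

lemma trace_inv_of_conj_eq_diagonal (hW : W ∈ Matrix.unitaryGroup (Fin n) ℂ)
    (h : Wᴴ * H * W = Matrix.diagonal d) (hd : ∀ i, d i ≠ 0) :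
    H⁻¹.trace = ∑ i, (d i)⁻¹ := by
  have h1 : Wᴴ * W = 1 := Matrix.mem_unitaryGroup_iff'.mp hW
  have h2 : W * Wᴴ = 1 := Matrix.mem_unitaryGroup_iff.mp hW
  have h3 : H⁻¹ = W * Matrix.diagonal (fun i => (d i)⁻¹) * Wᴴ := by
    apply Matrix.inv_eq_right_inv
    rw [eq_of_conj_eq_diagonal hW h]
    calc W * Matrix.diagonal d * Wᴴ * (W * Matrix.diagonal (fun i => (d i)⁻¹) * Wᴴ)
        = W * (Matrix.diagonal d * (Wᴴ * W) * Matrix.diagonal (fun i => (d i)⁻¹)) * Wᴴ := by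
          simp only [Matrix.mul_assoc]
      _ = 1 := by
          rw [h1, Matrix.mul_one, Matrix.diagonal_mul_diagonal]
          simp [hd, h2]
  rw [h3, Matrix.trace_mul_comm, ← Matrix.mul_assoc, h1, Matrix.one_mul, Matrix.trace_diagonal]

lemma rank_of_conj_eq_diagonal (hW : W ∈ Matrix.unitaryGroup (Fin n) ℂ)
    (h : Wᴴ * H * W = Matrix.diagonal d) : H.rank = (Matrix.diagonal d).rank := by
  have hu : IsUnit W.det := Matrix.isUnit_det_of_right_inverse (Matrix.mem_unitaryGroup_iff.mp hW)
  have hu' : IsUnit Wᴴ.det := Matrix.isUnit_det_of_right_inverse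
    (Matrix.mem_unitaryGroup_iff'.mp hW)
  rw [← h, Matrix.rank_mul_eq_left_of_isUnit_det _ _ hu,
    Matrix.rank_mul_eq_right_of_isUnit_det _ _ hu']

end conj

lemma rank_eq_card_sv {ι : Type*} [Fintype ι] {n : ℕ} (M : Matrix ι (Fin n) ℂ) :
    M.rank = (sv M).support.card := by
  rw [LinearMap.card_support_singularValues]
  rw [Matrix.rank_eq_finrank_range_toLin M (EuclideanSpace.basisFun ι ℂ).toBasis
    (EuclideanSpace.basisFun (Fin n) ℂ).toBasis, Matrix.toEuclideanLin_eq_toLin_orthonormal]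

lemma support_sv {ι : Type*} [Fintype ι] {n : ℕ} (M : Matrix ι (Fin n) ℂ) :
    (sv M).support = Finset.range M.rank := by
  rw [rank_eq_card_sv]
  simp [LinearMap.support_singularValues]

lemma sv_eq_zero_of_le {ι : Type*} [Fintype ι] {n : ℕ} (M : Matrix ι (Fin n) ℂ) {i : ℕ}
    (h : n ≤ i) : sv M i = 0 :=
  LinearMap.singularValues_of_finrank_le _ (by simpa using h)

/-- The right side sees only the nonzero singular values, so matrices of different sizes, such as
`R` and `B`, can be compared. -/
lemma invTrace_conjTranspose_mul_self {ι : Type*} [Fintype ι] {n : ℕ}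
    (M : Matrix ι (Fin n) ℂ) :
    invTrace (Mᴴ * M) = (sv M).sum fun _ x => ((x : ℂ) ^ 2)⁻¹ := by
  obtain ⟨W, hW, h⟩ := exists_unitary_conj_eq_diagonal M
  have h1 : invTrace (Mᴴ * M) = ∑ i : Fin n, (((sv M i : ℝ) : ℂ) ^ 2)⁻¹ := by
    rw [invTrace, charpoly_eq_of_conj_eq_diagonal hW h]
    exact invTrace_diagonal _
  rw [h1, Finsupp.sum_of_support_subset (s := Finset.range n), Finset.sum_range]
  · intro i hi
    by_contra hc
    exact Finsupp.mem_support_iff.mp hi (sv_eq_zero_of_le M (by simpa using hc))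
  · simp

lemma trace_inv_conjTranspose_mul_self {ι : Type*} [Fintype ι] {n : ℕ}
    (M : Matrix ι (Fin n) ℂ) (hM : M.rank = n) :
    (Mᴴ * M)⁻¹.trace = invTrace (Mᴴ * M) := by
  obtain ⟨W, hW, h⟩ := exists_unitary_conj_eq_diagonal M
  have hd : ∀ i : Fin n, ((sv M i : ℝ) : ℂ) ^ 2 ≠ 0 := by
    intro i
    have : (i : ℕ) ∈ (sv M).support := by rw [support_sv, hM]; simp
    simpa only [ne_eq, pow_eq_zero_iff two_ne_zero, Complex.ofReal_eq_zero,
      Finsupp.mem_support_iff] using this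
  rw [trace_inv_of_conj_eq_diagonal hW h hd, invTrace, charpoly_eq_of_conj_eq_diagonal hW h]
  exact (invTrace_diagonal _).symm

/-! ### The trace of `Q * Qᴴ` -/

lemma sum_castLE {k n : ℕ} (h : k ≤ n) {R : Type*} [AddCommMonoid R] (f : Fin n → R)
    (hf : ∀ i : Fin n, k ≤ i.1 → f i = 0) : ∑ i, f i = ∑ i : Fin k, f (Fin.castLE h i) := by
  symm
  refine (Finset.sum_map Finset.univ (Fin.castLEEmb h) f).symm.trans ?_
  refine Finset.sum_subset (Finset.subset_univ _) fun i _ hi => hf i ?_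
  by_contra hc
  exact hi (Finset.mem_map.mpr ⟨⟨i.1, by omega⟩, Finset.mem_univ _, rfl⟩)

lemma trace_padSquare_mul_conjTranspose {k n : ℕ} (h : k ≤ n) (Y : Matrix (Fin k) (Fin k) ℂ) :
    (padSquare n Y * (padSquare n Y)ᴴ).trace = (Y * Yᴴ).trace := by
  simp only [Matrix.trace, Matrix.diag, Matrix.mul_apply, Matrix.conjTranspose_apply]
  rw [sum_castLE h]
  · refine Finset.sum_congr rfl fun i _ => ?_
    rw [sum_castLE h]
    · simp [padSquare]
    · intro j hj
      simp [padSquare, hj.not_gt]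
  · intro i hi
    simp [padSquare, hi.not_gt]

theorem trace_mul_conjTranspose_of_isGSVDFactor {m n q : ℕ} {A : Matrix (Fin m) (Fin n) ℂ}
    {C : Matrix (Fin q) (Fin n) ℂ} {Q : Matrix (Fin n) (Fin n) ℂ} (h : IsGSVDFactor A C Q) :
    (Q * Qᴴ).trace = invTrace ((Matrix.fromRows A C)ᴴ * Matrix.fromRows A C) := by
  obtain ⟨k, r, s, U, V, α, β, h⟩ := h
  obtain ⟨Q', hQ', W, hW, ρ, hρ, hsv, rfl⟩ := h.form_Q
  have hk := h.k_eq
  set B := Matrix.fromRows A C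
  set R : Matrix (Fin k) (Fin k) ℂ := Matrix.diagonal fun i => ((ρ i : ℝ) : ℂ) with hR
  have hkn : k ≤ n := by rw [hk]; simpa using B.rank_le_card_width
  -- Equal singular values give equal ranks, so `R` is invertible and the inverse in `Q` is a
  -- genuine one.
  have hRk : R.rank = k := by
    rw [rank_eq_card_sv, sv, hsv, hk]
    exact (rank_eq_card_sv B).symm
  have hQQ : Q'ᴴ * Q' = 1 := Matrix.mem_unitaryGroup_iff'.mp hQ'
  have hWW : W * Wᴴ = 1 := Matrix.mem_unitaryGroup_iff.mp hW
  rw [Matrix.conjTranspose_mul, ← Matrix.mul_assoc, Matrix.trace_mul_comm, ← Matrix.mul_assoc,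
    ← Matrix.mul_assoc, hQQ, Matrix.one_mul, trace_padSquare_mul_conjTranspose hkn,
    invTrace_conjTranspose_mul_self, sv, ← hsv, ← invTrace_conjTranspose_mul_self,
    ← trace_inv_conjTranspose_mul_self R hRk, Matrix.conjTranspose_nonsing_inv,
    ← Matrix.mul_inv_rev, Matrix.conjTranspose_mul, Matrix.conjTranspose_conjTranspose]
  congr 2
  calc Rᴴ * W * (Wᴴ * R) = Rᴴ * (W * Wᴴ) * R := by simp only [Matrix.mul_assoc]
    _ = _ := by rw [hWW, Matrix.mul_one]

/-! ### The CS decomposition -/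

lemma eq_of_antitone_of_map_eq {k : ℕ} {f g : Fin k → ℝ} (hf : Antitone f) (hg : Antitone g)
    (h : Multiset.map f Finset.univ.val = Multiset.map g Finset.univ.val) : f = g := by
  rw [Fin.univ_val_map, Fin.univ_val_map, Multiset.coe_eq_coe] at h
  exact List.ofFn_injective (h.eq_of_sortedGE hf.sortedGE_ofFn hg.sortedGE_ofFn)

lemma sv_diagonal {k : ℕ} {ρ : Fin k → ℝ} (h0 : ∀ i, 0 ≤ ρ i) (hρ : Antitone ρ) (i : Fin k) :
    sv (Matrix.diagonal fun i => ((ρ i : ℝ) : ℂ)) i = ρ i := by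
  set R : Matrix (Fin k) (Fin k) ℂ := Matrix.diagonal fun i => ((ρ i : ℝ) : ℂ) with hR
  obtain ⟨W, hW, h⟩ := exists_unitary_conj_eq_diagonal R
  have h1 : Rᴴ * R = Matrix.diagonal fun i => ((ρ i : ℝ) : ℂ) ^ 2 := by
    rw [hR, Matrix.diagonal_conjTranspose, Matrix.diagonal_mul_diagonal]
    congr 1
    ext i
    simp [sq]
  have h2 := charpoly_eq_of_conj_eq_diagonal hW h
  rw [h1] at h2
  have roots : ∀ d : Fin k → ℂ, (Matrix.diagonal d).charpoly.roots =
      Multiset.map d Finset.univ.val := by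
    intro d
    rw [Matrix.charpoly_diagonal, Polynomial.roots_prod _ _
      (by simp [Finset.prod_ne_zero_iff, Polynomial.X_sub_C_ne_zero])]
    simp
  -- Square roots of real parts turn the complex eigenvalues back into the numbers `ρ i` and the
  -- singular values.
  have h3 := congrArg (fun p => p.roots.map fun z : ℂ => √z.re) h2
  simp only [roots, Multiset.map_map, Function.comp_def, ← Complex.ofReal_pow,
    Complex.ofReal_re] at h3
  simp only [Real.sqrt_sq (h0 _), Real.sqrt_sq (LinearMap.singularValues_nonneg _ _)] at h3
  have h4 := eq_of_antitone_of_map_eq hρ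
    (fun a b hab => LinearMap.singularValues_antitone _ hab) h3
  exact (congrFun h4 i).symm

/-- The columns of `M` are orthogonal with norms `|d j|`. The nonzero ones, divided by `d j`, extend
to an orthonormal basis in which they occupy the positions prescribed by `φ`; `U` passes to
coordinates in that basis. -/
lemma exists_unitary_mul_apply {m k : ℕ} (M : Matrix (Fin m) (Fin k) ℂ) (d : Fin k → ℝ)
    (hM : Mᴴ * M = Matrix.diagonal fun j => ((d j : ℝ) : ℂ) ^ 2)
    (φ : {j // d j ≠ 0} → Fin m) (hφ : Function.Injective φ) :
    ∃ U ∈ Matrix.unitaryGroup (Fin m) ℂ, ∀ i j, (U * M) i j =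
      if h : d j ≠ 0 then (if φ ⟨j, h⟩ = i then ((d j : ℝ) : ℂ) else 0) else 0 := by
  classical
  have hM' : ∀ i j, ∑ l, star (M l i) * M l j = if i = j then ((d i : ℝ) : ℂ) ^ 2 else 0 := by
    intro i j
    have := congrFun (congrFun hM i) j
    simpa [Matrix.mul_apply, Matrix.diagonal_apply] using this
  set u : {j // d j ≠ 0} → EuclideanSpace ℂ (Fin m) :=
    fun j => WithLp.toLp 2 fun l => ((d j : ℝ) : ℂ)⁻¹ * M l j with hu
  have huo : ∀ x y, inner ℂ (u x) (u y) = if x = y then (1 : ℂ) else 0 := by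
    intro x y
    have hx : ((d x : ℝ) : ℂ) ≠ 0 := by exact_mod_cast x.2
    calc inner ℂ (u x) (u y)
        = ((d x : ℝ) : ℂ)⁻¹ * ((d y : ℝ) : ℂ)⁻¹ * ∑ l, star (M l x) * M l y := by
          rw [PiLp.inner_apply, Finset.mul_sum]
          refine Finset.sum_congr rfl fun l _ => ?_
          simp only [hu, RCLike.inner_apply, map_mul, map_inv₀, Complex.conj_ofReal,
            Complex.star_def]
          ring
      _ = _ := by
          rw [hM']
          by_cases hxy : x = y
          · subst hxy
            simp only [if_true]
            field_simp
          · simp [hxy, Subtype.ext_iff.not.mp hxy]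
  -- The extension by `0` only reindexes `u` by `Fin m`; its values off the range of `φ` play no
  -- role.
  have hext : ∀ x, Function.extend φ u 0 (φ x) = u x := fun x => hφ.extend_apply _ _ _
  have horth : Orthonormal ℂ ((Set.range φ).domRestrict (Function.extend φ u 0)) := by
    rw [orthonormal_iff_ite]
    rintro ⟨_, x, rfl⟩ ⟨_, y, rfl⟩
    change inner ℂ (Function.extend φ u 0 (φ x)) (Function.extend φ u 0 (φ y)) = _
    rw [hext, hext, huo]
    refine if_congr ⟨?_, fun h => hφ (congrArg Subtype.val h)⟩ rfl rfl
    rintro rfl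
    rfl
  obtain ⟨b, hb⟩ := horth.exists_orthonormalBasis_extension_of_card_eq (by simp)
  have hbφ : ∀ x, b (φ x) = u x := fun x => (hb _ ⟨x, rfl⟩).trans (hext x)
  refine ⟨(Matrix.of fun i j => b j i)ᴴ,
    Unitary.star_mem (mem_unitaryGroup_of_orthonormalBasis b), fun i j => ?_⟩
  by_cases h : d j ≠ 0
  · have hx : ((d j : ℝ) : ℂ) ≠ 0 := by exact_mod_cast h
    rw [dif_pos h]
    have h1 := orthonormal_iff_ite.mp b.orthonormal i (φ ⟨j, h⟩)
    rw [hbφ, PiLp.inner_apply] at h1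
    have h2 : (((Matrix.of fun i j => b j i)ᴴ * M : Matrix (Fin m) (Fin k) ℂ)) i j =
        ((d j : ℝ) : ℂ) * ∑ l, inner ℂ (b i l) (u ⟨j, h⟩ l) := by
      rw [Matrix.mul_apply, Finset.mul_sum]
      refine Finset.sum_congr rfl fun l _ => ?_
      simp only [hu, RCLike.inner_apply, Matrix.conjTranspose_apply, Matrix.of_apply,
        Complex.star_def]
      field_simp
    rw [h2, h1]
    simp [eq_comm]
  · rw [dif_neg h]
    push Not at h
    have h1 := hM' j j
    rw [if_pos rfl, h] at h1
    have h2 : ∑ l, ‖M l j‖ ^ 2 = 0 := by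
      have : ((∑ l, ‖M l j‖ ^ 2 : ℝ) : ℂ) = 0 := by
        push_cast
        rw [← (by simpa using h1 : ∑ l, star (M l j) * M l j = 0)]
        refine Finset.sum_congr rfl fun l _ => ?_
        rw [Complex.star_def, Complex.conj_mul']
      exact_mod_cast this
    have h3 := (Finset.sum_eq_zero_iff_of_nonneg (fun l _ => sq_nonneg ‖M l j‖)).mp h2
    have h4 : ∀ l, M l j = 0 := fun l => by simpa using h3 l (Finset.mem_univ l)
    simp [Matrix.mul_apply, h4]

lemma iff_lt_card_filter {k : ℕ} (p : Fin k → Prop) [DecidablePred p]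
    (hp : ∀ i j, i ≤ j → p j → p i) (j : Fin k) :
    p j ↔ j.1 < (Finset.univ.filter p).card := by
  constructor
  · intro h
    have : Finset.Iic j ⊆ Finset.univ.filter p := fun i hi => by
      simpa using hp i j (Finset.mem_Iic.mp hi) h
    have := Finset.card_le_card this
    rw [Fin.card_Iic] at this
    omega
  · intro h
    by_contra hc
    have : Finset.univ.filter p ⊆ Finset.Iio j := fun i hi => by
      rw [Finset.mem_Iio]
      by_contra hij
      exact hc (hp j i (not_lt.mp hij) (by simpa using hi))
    have := Finset.card_le_card this
    rw [Fin.card_Iio] at this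
    omega

open scoped ComplexOrder in
/-- The CS decomposition of a matrix with orthonormal columns, split into two blocks of rows. -/
theorem exists_cs_decomposition {m q k : ℕ} (A : Matrix (Fin m) (Fin k) ℂ)
    (C : Matrix (Fin q) (Fin k) ℂ) (h : Aᴴ * A + Cᴴ * C = 1) :
    ∃ U ∈ Matrix.unitaryGroup (Fin m) ℂ, ∃ V ∈ Matrix.unitaryGroup (Fin q) ℂ,
      ∃ W ∈ Matrix.unitaryGroup (Fin k) ℂ, ∃ α β : Fin (A.rank + C.rank - k) → ℝ,
      (∀ i, 0 ≤ α i) ∧ (∀ i, 0 ≤ β i) ∧ (∀ i, α i ^ 2 + β i ^ 2 = 1) ∧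
      U * A * W = sigmaA m k (k - C.rank) (A.rank + C.rank - k) α ∧
      V * C * W = sigmaC q k (k - C.rank) (A.rank + C.rank - k) β := by
  classical
  obtain ⟨W, hW, hWA⟩ := exists_unitary_conj_eq_diagonal A
  set a : ℕ → ℝ := fun j => sv A j with ha
  have hWW : Wᴴ * W = 1 := Matrix.mem_unitaryGroup_iff'.mp hW
  -- As `Cᴴ * C = 1 - Aᴴ * A`, the same `W` diagonalizes both Gram matrices.
  have hWC : Wᴴ * (Cᴴ * C) * W = Matrix.diagonal fun j : Fin k => 1 - (a j : ℂ) ^ 2 := by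
    rw [eq_sub_of_add_eq' h, Matrix.mul_sub, Matrix.sub_mul, hWA, Matrix.mul_one, hWW,
      ← Matrix.diagonal_one, Matrix.diagonal_sub]
  have ha0 : ∀ j, 0 ≤ a j := LinearMap.singularValues_nonneg _
  have hanti : Antitone a := LinearMap.singularValues_antitone _
  have ha1 : ∀ j : Fin k, 0 ≤ 1 - a j ^ 2 := by
    intro j
    have h1 := congrFun (congrFun hWC j) j
    have h2 : Wᴴ * (Cᴴ * C) * W = (C * W)ᴴ * (C * W) := by
      simp only [Matrix.conjTranspose_mul, Matrix.mul_assoc]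
    rw [h2, Matrix.mul_apply, Matrix.diagonal_apply_eq] at h1
    have h3 : ((1 - a j ^ 2 : ℝ) : ℂ) = ((∑ l, ‖(C * W) l j‖ ^ 2 : ℝ) : ℂ) := by
      push_cast
      rw [← h1]
      refine Finset.sum_congr rfl fun l _ => ?_
      rw [Matrix.conjTranspose_apply, Complex.star_def, Complex.conj_mul']
    rw [Complex.ofReal_inj.mp h3]
    positivity
  have ha1' : ∀ j : Fin k, a j ≤ 1 := fun j => by nlinarith [ha1 j, ha0 j]
  have hone : ∀ j : Fin k, a j = 1 ↔ (1 - (a j : ℂ) ^ 2) = 0 := by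
    intro j
    have : (1 - (a j : ℂ) ^ 2) = ((1 - a j ^ 2 : ℝ) : ℂ) := by push_cast; rfl
    rw [this, Complex.ofReal_eq_zero]
    constructor
    · intro h; rw [h]; norm_num
    · intro h; nlinarith [ha0 j]
  have hCq : C.rank ≤ q := by simpa using C.rank_le_card_height
  have hCk : C.rank ≤ k := by simpa using C.rank_le_card_width
  have hAm : A.rank ≤ m := by simpa using A.rank_le_card_height
  have hAk : A.rank ≤ k := by simpa using A.rank_le_card_width
  -- The rank of `C` counts the nonzero entries `1 - a j ^ 2`, so exactly `k - C.rank` of the `a j`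
  -- equal `1`; by monotonicity they come first.
  have hcard : (Finset.univ.filter fun j : Fin k => a j = 1).card = k - C.rank := by
    have h1 : C.rank = (Finset.univ.filter fun j : Fin k => ¬ a j = 1).card := by
      rw [← Matrix.rank_conjTranspose_mul_self, rank_of_conj_eq_diagonal hW hWC,
        Matrix.rank_diagonal, Fintype.card_subtype]
      simp only [ne_eq, hone]
    have h2 := Finset.card_filter_add_card_filter_not (s := Finset.univ)
      (fun j : Fin k => a j = 1)
    rw [← h1, Finset.card_univ, Fintype.card_fin] at h2
    omega
  have hr : ∀ j : Fin k, a j = 1 ↔ j.1 < k - C.rank := by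
    intro j
    rw [← hcard]
    exact iff_lt_card_filter (fun j : Fin k => a j = 1)
      (fun i j hij hj => le_antisymm (ha1' i) (hj ▸ hanti hij)) j
  have hp : ∀ j : ℕ, a j ≠ 0 ↔ j < A.rank := by
    intro j
    rw [ha, ← Finsupp.mem_support_iff, support_sv, Finset.mem_range]
  -- Otherwise `a` would be both `1` and `0` at the index `A.rank`. Hence the subtraction in `A.rank
  -- + C.rank - k` does not truncate.
  have hrp : k - C.rank ≤ A.rank := by
    by_contra hc
    have h1 := (hr ⟨A.rank, by omega⟩).mpr (by simp only; omega)
    have h2 := (hp A.rank).not.mpr (lt_irrefl _)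
    simp only at h1
    rw [h1] at h2
    simp at h2
  set b : Fin k → ℝ := fun j => √(1 - a j ^ 2) with hb
  have hbne : ∀ j, b j ≠ 0 ↔ k - C.rank ≤ j.1 := by
    intro j
    rw [hb, Real.sqrt_ne_zero (ha1 j), ← not_lt, ← hr, hone, not_iff_not,
      ← Complex.ofReal_eq_zero]
    push_cast
    rfl
  obtain ⟨U, hU, hUA⟩ := exists_unitary_mul_apply (A * W) (fun j : Fin k => a j)
    (by rw [← hWA]; simp only [Matrix.conjTranspose_mul, Matrix.mul_assoc])
    (fun j => ⟨j.1.1, ((hp _).mp j.2).trans_le hAm⟩) (fun x y hxy => by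
      ext; simpa using hxy)
  obtain ⟨V, hV, hVC⟩ := exists_unitary_mul_apply (C * W) b
    (by
      have : (fun j : Fin k => (b j : ℂ) ^ 2) = fun j : Fin k => 1 - (a j : ℂ) ^ 2 := by
        ext j
        rw [← Complex.ofReal_pow, hb, Real.sq_sqrt (ha1 j)]
        push_cast
        rfl
      rw [this, ← hWC]
      simp only [Matrix.conjTranspose_mul, Matrix.mul_assoc])
    -- The row that `sigmaC` assigns to column `j`. No truncation occurs, because `k - C.rank ≤ j`
    -- and `C.rank ≤ q`.
    (fun j => ⟨q + j.1.1 - k, by have := j.1.2; have := (hbne _).mp j.2; omega⟩)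
    (fun x y hxy => by
      have h1 := (hbne _).mp x.2
      have h2 := (hbne _).mp y.2
      simp only [Fin.mk.injEq] at hxy
      ext
      omega)
  have hlt : ∀ i : Fin (A.rank + C.rank - k), k - C.rank + i.1 < k := fun i => by
    have := i.2
    omega
  refine ⟨U, hU, V, hV, W, hW, fun i => a (k - C.rank + i), fun i => b ⟨k - C.rank + i, hlt i⟩,
    fun i => ha0 _, fun i => Real.sqrt_nonneg _, fun i => ?_, ?_, ?_⟩
  · have := Real.sq_sqrt (ha1 ⟨k - C.rank + i, hlt i⟩)
    simp only [hb]
    rw [this]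
    ring
  · ext i j
    rw [Matrix.mul_assoc, hUA, sigmaA, Matrix.of_apply]
    simp only [Fin.ext_iff]
    by_cases hij : j.1 = i.1
    · by_cases h1 : j.1 < k - C.rank
      · have h2 := (hr j).mpr h1
        simp [← hij, h1, h2]
      · by_cases h2 : j.1 - (k - C.rank) < A.rank + C.rank - k
        · have h3 := (hp j).mpr (by omega)
          have h4 : k - C.rank + (j.1 - (k - C.rank)) = j.1 := by omega
          simp [← hij, h1, h2, h3, h4]
        · have h3 := (hp j).not.mpr (by omega)
          push Not at h3
          simp [← hij, h1, h2, h3]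
    · simp [hij, Ne.symm hij]
  · ext i j
    rw [Matrix.mul_assoc, hVC, sigmaC, Matrix.of_apply]
    simp only [Fin.ext_iff]
    have hj := j.2
    by_cases h1 : k - C.rank ≤ j.1
    · rw [dif_pos ((hbne j).mpr h1)]
      by_cases hij : i.1 + k = q + j.1
      · rw [if_pos (by omega), if_pos ⟨h1, hij⟩]
        by_cases h2 : j.1 - (k - C.rank) < A.rank + C.rank - k
        · have h4 : k - C.rank + (j.1 - (k - C.rank)) = j.1 := by omega
          simp [h2, h4]
        · have h3 := (hp j).not.mpr (by omega)
          push Not at h3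
          simp [h2, hb, h3]
      · rw [if_neg (by omega), if_neg (by tauto)]
    · rw [dif_neg ((hbne j).not.mpr h1), if_neg (by tauto)]

/-! ### Existence of a GSVD -/

section pad

variable {m k n : ℕ}

/-- Padding becomes multiplication by the coisometry `E = padCols n 1`, with `E * Eᴴ = 1` when `k ≤
n`, so block identities follow by associativity. -/
lemma padCols_eq_mul (M : Matrix (Fin m) (Fin k) ℂ) :
    padCols n M = M * padCols n (1 : Matrix (Fin k) (Fin k) ℂ) := by
  ext i j
  by_cases hj : j.1 < k
  · simp [padCols, Matrix.mul_apply, hj, Matrix.one_apply]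
  · simp [padCols, Matrix.mul_apply, hj]

lemma padCols_one_mul_conjTranspose (h : k ≤ n) :
    padCols n (1 : Matrix (Fin k) (Fin k) ℂ) * (padCols n (1 : Matrix (Fin k) (Fin k) ℂ))ᴴ = 1 := by
  ext i j
  rw [Matrix.mul_apply, sum_castLE h]
  · simp [padCols, Matrix.one_apply, apply_ite]
  · intro l hl
    simp [padCols, hl.not_gt]

lemma padSquare_eq_mul (M : Matrix (Fin k) (Fin k) ℂ) :
    padSquare n M = (padCols n (1 : Matrix (Fin k) (Fin k) ℂ))ᴴ *
      (M * padCols n (1 : Matrix (Fin k) (Fin k) ℂ)) := by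
  rw [← padCols_eq_mul]
  ext i j
  by_cases hi : i.1 < k <;> by_cases hj : j.1 < k <;>
  simp [padCols, padSquare, Matrix.mul_apply, hi, hj, Matrix.one_apply, apply_ite]

lemma padCols_mul_padSquare (h : k ≤ n) (M : Matrix (Fin m) (Fin k) ℂ)
    (N : Matrix (Fin k) (Fin k) ℂ) : padCols n M * padSquare n N = padCols n (M * N) := by
  have hE := padCols_one_mul_conjTranspose h
  rw [padCols_eq_mul, padSquare_eq_mul, padCols_eq_mul (M * N)]
  set E : Matrix (Fin k) (Fin n) ℂ := padCols n (1 : Matrix (Fin k) (Fin k) ℂ)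
  calc M * E * (Eᴴ * (N * E)) = M * (E * Eᴴ) * (N * E) := by simp only [Matrix.mul_assoc]
    _ = _ := by rw [hE, Matrix.mul_one, Matrix.mul_assoc]

lemma rank_padCols (h : k ≤ n) (M : Matrix (Fin m) (Fin k) ℂ) : (padCols n M).rank = M.rank := by
  apply le_antisymm
  · rw [padCols_eq_mul]
    exact Matrix.rank_mul_le_left _ _
  · calc M.rank = (padCols n M * (padCols n (1 : Matrix (Fin k) (Fin k) ℂ))ᴴ).rank := by
          rw [padCols_eq_mul, Matrix.mul_assoc, padCols_one_mul_conjTranspose h, Matrix.mul_one]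
      _ ≤ _ := Matrix.rank_mul_le_left _ _

end pad

/-- Write `B * Q' = (B' * R, O)`, where `B'` has orthonormal columns and `R` holds the nonzero
singular values. The CS decomposition of the two row blocks of `B'` supplies `U`, `V`, `W`; since `R
* (Wᴴ * R)⁻¹ = W`, the required `Q` puts both blocks in normal form. -/
lemma exists_gsvd {m n q : ℕ} (A : Matrix (Fin m) (Fin n) ℂ) (C : Matrix (Fin q) (Fin n) ℂ) :
    ∃ Q, IsGSVDFactor A C Q := by
  set B := Matrix.fromRows A C with hB
  obtain ⟨Q', hQ', hQB⟩ := exists_unitary_conj_eq_diagonal B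
  obtain ⟨k, hk⟩ : ∃ k, k = B.rank := ⟨_, rfl⟩
  have hkn : k ≤ n := by rw [hk]; simpa using B.rank_le_card_width
  set σ : ℕ → ℝ := fun i => sv B i with hσ
  have hσk : ∀ i, σ i ≠ 0 ↔ i < k := fun i => by
    rw [hσ, ← Finsupp.mem_support_iff, support_sv, Finset.mem_range, hk]
  have hσ0 : ∀ i, 0 ≤ σ i := LinearMap.singularValues_nonneg _
  set R : Matrix (Fin k) (Fin k) ℂ := Matrix.diagonal fun i => ((σ i : ℝ) : ℂ) with hR
  have hRsv : sv R = sv B := by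
    ext i
    by_cases hi : i < k
    · exact sv_diagonal (ρ := fun i : Fin k => σ i) (fun i => hσ0 _)
        (fun i j hij => LinearMap.singularValues_antitone _ hij) ⟨i, hi⟩
    · rw [sv_eq_zero_of_le R (not_lt.mp hi)]
      exact (not_not.mp ((hσk i).not.mpr hi)).symm
  have hσne : ∀ i : Fin k, ((σ i : ℝ) : ℂ) ≠ 0 := fun i => by
    exact_mod_cast (hσk i).mpr i.2
  have hRdet : IsUnit R.det := by
    rw [hR, Matrix.det_diagonal, isUnit_iff_ne_zero, Finset.prod_ne_zero_iff]
    exact fun i _ => hσne i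
  have hBQ : ∀ i j, ∑ l, star ((B * Q') l i) * (B * Q') l j =
      if i = j then ((σ i : ℝ) : ℂ) ^ 2 else 0 := by
    intro i j
    have h1 : Q'ᴴ * (Bᴴ * B) * Q' = (B * Q')ᴴ * (B * Q') := by
      simp only [Matrix.conjTranspose_mul, Matrix.mul_assoc]
    have := congrFun (congrFun (h1.symm.trans hQB) i) j
    rw [Matrix.mul_apply, Matrix.diagonal_apply] at this
    exact this
  set B' : Matrix (Fin m ⊕ Fin q) (Fin k) ℂ :=
    Matrix.of fun i j => (B * Q') i (Fin.castLE hkn j) * ((σ j : ℝ) : ℂ)⁻¹ with hB'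
  have hB'1 : B'ᴴ * B' = 1 := by
    ext i j
    have h1 := hBQ (Fin.castLE hkn i) (Fin.castLE hkn j)
    have h2 : (B'ᴴ * B') i j = ((σ i : ℝ) : ℂ)⁻¹ * ((σ j : ℝ) : ℂ)⁻¹ *
        ∑ l, star ((B * Q') l (Fin.castLE hkn i)) * (B * Q') l (Fin.castLE hkn j) := by
      rw [Matrix.mul_apply, Finset.mul_sum]
      refine Finset.sum_congr rfl fun l _ => ?_
      simp only [hB', Matrix.conjTranspose_apply, Matrix.of_apply, star_mul', Complex.star_def,
        map_inv₀, Complex.conj_ofReal]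
      ring
    rw [h2, h1]
    by_cases hij : i = j
    · subst hij
      have := hσne i
      simp only [if_true, Fin.val_castLE, Matrix.one_apply_eq]
      field_simp
    · simp [hij]
  have hBQz : ∀ i (j : Fin n), k ≤ j.1 → (B * Q') i j = 0 := by
    intro i j hj
    have h1 := hBQ j j
    rw [if_pos rfl, not_not.mp ((hσk j).not.mpr (not_lt.mpr hj))] at h1
    have h2 : ∑ l, ‖(B * Q') l j‖ ^ 2 = 0 := by
      have : ((∑ l, ‖(B * Q') l j‖ ^ 2 : ℝ) : ℂ) = 0 := by
        push_cast
        rw [← (by simpa using h1 : ∑ l, star ((B * Q') l j) * (B * Q') l j = 0)]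
        refine Finset.sum_congr rfl fun l _ => ?_
        rw [Complex.star_def, Complex.conj_mul']
      exact_mod_cast this
    have h3 := (Finset.sum_eq_zero_iff_of_nonneg (fun l _ => sq_nonneg ‖(B * Q') l j‖)).mp h2
    simpa using h3 i (Finset.mem_univ i)
  have hBQ' : ∀ i j, (B * Q') i j = if h : j.1 < k then (B' * R) i ⟨j.1, h⟩ else 0 := by
    intro i j
    split_ifs with h
    · rw [hR, Matrix.mul_diagonal, hB', Matrix.of_apply, mul_assoc,
        inv_mul_cancel₀ (hσne ⟨j.1, h⟩), mul_one]
      rfl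
    · exact hBQz i j (not_lt.mp h)
  set A₁ := B'.toRows₁ with hA₁
  set C₁ := B'.toRows₂ with hC₁
  have hsum : A₁ᴴ * A₁ + C₁ᴴ * C₁ = 1 := by
    rw [← hB'1, ← Matrix.fromCols_mul_fromRows,
      ← Matrix.conjTranspose_fromRows_eq_fromCols_conjTranspose, Matrix.fromRows_toRows]
  have hAQ : A * Q' = padCols n (A₁ * R) := by
    ext i j
    exact hBQ' (Sum.inl i) j
  have hCQ : C * Q' = padCols n (C₁ * R) := by
    ext i j
    exact hBQ' (Sum.inr i) j
  have hQdet : IsUnit Q'.det := Matrix.isUnit_det_of_right_inverse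
    (Matrix.mem_unitaryGroup_iff.mp hQ')
  have hrA : A.rank = A₁.rank := by
    rw [← Matrix.rank_mul_eq_left_of_isUnit_det _ _ hQdet, hAQ, rank_padCols hkn,
      Matrix.rank_mul_eq_left_of_isUnit_det _ _ hRdet]
  have hrC : C.rank = C₁.rank := by
    rw [← Matrix.rank_mul_eq_left_of_isUnit_det _ _ hQdet, hCQ, rank_padCols hkn,
      Matrix.rank_mul_eq_left_of_isUnit_det _ _ hRdet]
  obtain ⟨U, hU, V, hV, W, hW, α, β, hα, hβ, hαβ, hUA, hVC⟩ := exists_cs_decomposition A₁ C₁ hsum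
  have hWW : W * Wᴴ = 1 := Matrix.mem_unitaryGroup_iff.mp hW
  have hWR : R * (Wᴴ * R)⁻¹ = W := by
    rw [Matrix.mul_inv_rev, ← Matrix.mul_assoc, Matrix.mul_nonsing_inv _ hRdet, Matrix.one_mul]
    exact Matrix.inv_eq_left_inv hWW
  have key : ∀ {l : ℕ} (X : Matrix (Fin l) (Fin l) ℂ) (M : Matrix (Fin l) (Fin n) ℂ)
      (M₁ : Matrix (Fin l) (Fin k) ℂ), M * Q' = padCols n (M₁ * R) →
      X * M * (Q' * padSquare n ((Wᴴ * R)⁻¹)) = padCols n (X * M₁ * W) := by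
    intro l X M M₁ hM
    calc X * M * (Q' * padSquare n ((Wᴴ * R)⁻¹)) = X * ((M * Q') * padSquare n ((Wᴴ * R)⁻¹)) := by
          simp only [Matrix.mul_assoc]
      _ = X * padCols n (M₁ * W) := by
          rw [hM, padCols_mul_padSquare hkn, Matrix.mul_assoc, hWR]
      _ = _ := by
          rw [padCols_eq_mul, padCols_eq_mul (X * M₁ * W)]
          simp only [Matrix.mul_assoc]
  exact ⟨Q' * padSquare n ((Wᴴ * R)⁻¹), k, k - C₁.rank, A₁.rank + C₁.rank - k, U, V, α, β,
    { k_eq := hk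
      r_eq := by rw [← hB, ← hk, hrC]
      s_eq := by rw [← hB, ← hk, hrA, hrC]
      unitary_U := hU
      unitary_V := hV
      α_nonneg := hα
      β_nonneg := hβ
      sq_add_sq := hαβ
      decomp_A := by rw [key U A A₁ hAQ, hUA]
      decomp_C := by rw [key V C C₁ hCQ, hVC]
      form_Q := ⟨Q', hQ', W, hW, fun i => σ i, fun i => hσ0 i, hRsv, rfl⟩ }⟩

/-! ### Inverse moments of Gaussian norms -/

open MeasureTheory ProbabilityTheory

lemma integral_exp_neg_mul_sq_gaussianReal {t : ℝ} (ht : 0 ≤ t) :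
    ∫ x, Real.exp (-(t * x ^ 2)) ∂gaussianReal 0 1 = (√(1 + 2 * t))⁻¹ := by
  rw [integral_gaussianReal_eq_integral_smul one_ne_zero]
  have h : ∀ x : ℝ, gaussianPDFReal 0 1 x • Real.exp (-(t * x ^ 2)) =
      (√(2 * Real.pi))⁻¹ * Real.exp (-(1 / 2 + t) * x ^ 2) := by
    intro x
    rw [gaussianPDFReal, smul_eq_mul, mul_assoc, ← Real.exp_add]
    simp only [NNReal.coe_one, mul_one, sub_zero]
    congr 2
    ring
  simp_rw [h]
  rw [integral_const_mul, integral_gaussian, ← Real.sqrt_inv, ← Real.sqrt_inv,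
    ← Real.sqrt_mul (by positivity)]
  congr 1
  have := Real.pi_pos
  field_simp

section real

variable {E : Type*} [NormedAddCommGroup E] [InnerProductSpace ℝ E] [FiniteDimensional ℝ E]
  [MeasurableSpace E] [BorelSpace E]

lemma integral_exp_neg_mul_norm_sq_stdGaussian {t : ℝ} (ht : 0 ≤ t) :
    ∫ x, Real.exp (-(t * ‖x‖ ^ 2)) ∂stdGaussian E = (√(1 + 2 * t))⁻¹ ^ Module.finrank ℝ E := by
  rw [stdGaussian, integral_map (Measurable.aemeasurable (by fun_prop))
    (Measurable.aestronglyMeasurable (by fun_prop))]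
  have h : ∀ x : Fin (Module.finrank ℝ E) → ℝ,
      Real.exp (-(t * ‖∑ i, x i • stdOrthonormalBasis ℝ E i‖ ^ 2)) =
        ∏ i, Real.exp (-(t * x i ^ 2)) := by
    intro x
    rw [← Real.exp_sum, Finset.sum_neg_distrib, ← Finset.mul_sum]
    congr 3
    rw [← (stdOrthonormalBasis ℝ E).sum_sq_norm_inner_right]
    refine Finset.sum_congr rfl fun i _ => ?_
    rw [(stdOrthonormalBasis ℝ E).orthonormal.inner_right_fintype]
    simp
  simp_rw [h]
  rw [integral_fintype_prod_eq_pow (fun x => Real.exp (-(t * x ^ 2))),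
    integral_exp_neg_mul_sq_gaussianReal ht, Fintype.card_fin]

/-- Working in `ENNReal` covers `a = 0`, where both sides are infinite. -/
lemma lintegral_exp_neg_mul_Ioi {a : ℝ} (ha : 0 ≤ a) :
    ∫⁻ t in Set.Ioi (0 : ℝ), ENNReal.ofReal (Real.exp (-(t * a))) = (ENNReal.ofReal a)⁻¹ := by
  rcases ha.eq_or_lt with rfl | ha
  · simp
  · have h := integral_exp_mul_Ioi (neg_lt_zero.mpr ha) 0
    have hi := integrableOn_exp_mul_Ioi (neg_lt_zero.mpr ha) 0
    have e : ∀ t : ℝ, Real.exp (-(t * a)) = Real.exp (-a * t) := fun t => by congr 1; ring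
    simp_rw [e]
    rw [← ofReal_integral_eq_lintegral_ofReal hi (Filter.Eventually.of_forall fun t => by positivity),
      h, ← ENNReal.ofReal_inv_of_pos ha]
    congr 1
    simp

lemma lintegral_inv_one_add_pow {e : ℕ} (he : e ≠ 0) :
    ∫⁻ t in Set.Ioi (0 : ℝ), ENNReal.ofReal ((1 + 2 * t)⁻¹ ^ (e + 1)) =
      ENNReal.ofReal (1 / (2 * e)) := by
  have he' : (e : ℝ) ≠ 0 := by exact_mod_cast he
  have hd : ∀ x ∈ Set.Ici (0 : ℝ), HasDerivAt (fun t : ℝ => -(1 / (2 * e)) * (1 + 2 * t)⁻¹ ^ e)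
      ((1 + 2 * x)⁻¹ ^ (e + 1)) x := by
    intro x hx
    have hx : (0 : ℝ) ≤ x := hx
    have h0 : 1 + 2 * x ≠ 0 := by positivity
    have h1 : HasDerivAt (fun t : ℝ => 1 + 2 * t) 2 x := by
      simpa using ((hasDerivAt_id x).const_mul 2).const_add 1
    convert! ((h1.inv h0).pow e).const_mul (-(1 / (2 * (e : ℝ)))) using 1
    obtain ⟨k, rfl⟩ := Nat.exists_eq_succ_of_ne_zero he
    simp only [Nat.succ_eq_add_one, add_tsub_cancel_right, Pi.inv_apply, inv_pow]
    field_simp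
    ring
  have htend : Filter.Tendsto (fun t : ℝ => -(1 / (2 * e)) * (1 + 2 * t)⁻¹ ^ e) Filter.atTop
      (nhds 0) := by
    have h1 : Filter.Tendsto (fun t : ℝ => 1 + 2 * t) Filter.atTop Filter.atTop :=
      Filter.tendsto_atTop_add_const_left _ _ (Filter.tendsto_id.const_mul_atTop two_pos)
    have h2 := ((tendsto_inv_atTop_zero.comp h1).pow e).const_mul (-(1 / (2 * (e : ℝ))))
    simpa [he] using h2
  have hpos : ∀ x ∈ Set.Ioi (0 : ℝ), 0 ≤ (1 + 2 * x)⁻¹ ^ (e + 1) := by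
    intro x hx
    have : (0 : ℝ) < x := hx
    positivity
  have hint := integrableOn_Ioi_deriv_of_nonneg' hd hpos htend
  have hval := integral_Ioi_of_hasDerivAt_of_nonneg' hd hpos htend
  rw [← ofReal_integral_eq_lintegral_ofReal hint
    ((ae_restrict_iff' measurableSet_Ioi).mpr (Filter.Eventually.of_forall hpos)), hval]
  simp

/-- Write `1 / ‖x‖²` as the integral of `exp (-t ‖x‖²)` over `t > 0` and exchange integrals. The
even real dimension turns the square root into the integer power `e + 1`. -/
lemma lintegral_inv_norm_sq_stdGaussian {e : ℕ} (he : e ≠ 0)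
    (hE : Module.finrank ℝ E = 2 * (e + 1)) :
    ∫⁻ x, (ENNReal.ofReal (‖x‖ ^ 2))⁻¹ ∂stdGaussian E = ENNReal.ofReal (1 / (2 * e)) := by
  simp_rw [← lintegral_exp_neg_mul_Ioi (sq_nonneg _)]
  rw [lintegral_lintegral_swap (Measurable.aemeasurable (by fun_prop)),
    ← lintegral_inv_one_add_pow he]
  refine setLIntegral_congr_fun measurableSet_Ioi fun t ht => ?_
  have ht : 0 < t := ht
  have hi : Integrable (fun x : E => Real.exp (-(t * ‖x‖ ^ 2))) (stdGaussian E) := by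
    refine Integrable.of_bound (C := 1) (Measurable.aestronglyMeasurable (by fun_prop))
      (Filter.Eventually.of_forall fun x => ?_)
    rw [Real.norm_eq_abs, Real.abs_exp, Real.exp_le_one_iff, Left.neg_nonpos_iff]
    positivity
  rw [← ofReal_integral_eq_lintegral_ofReal hi (Filter.Eventually.of_forall fun x => by positivity),
    integral_exp_neg_mul_norm_sq_stdGaussian ht.le, hE, pow_mul, inv_pow, Real.sq_sqrt (by positivity)]

lemma lintegral_inv_norm_sq_of_charFun {e : ℕ} (he : e ≠ 0)
    (hE : Module.finrank ℝ E = 2 * (e + 1)) (μ : Measure E) [IsFiniteMeasure μ]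
    (hμ : ∀ t, charFun μ t = Complex.exp (-‖t‖ ^ 2 / 4)) :
    ∫⁻ x, (ENNReal.ofReal (‖x‖ ^ 2))⁻¹ ∂μ = ENNReal.ofReal (1 / e) := by
  -- Variance `1/2` per real coordinate: `μ` is the standard Gaussian scaled by `1/√2`, which
  -- doubles the inverse moment.
  have h : μ = (stdGaussian E).map (fun x => (√2)⁻¹ • x) := by
    apply Measure.ext_of_charFun
    ext t
    rw [hμ, charFun_map_smul, charFun_stdGaussian, norm_smul]
    congr 1
    have : (((√2 : ℝ) : ℂ)) ^ 2 = 2 := by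
      rw [← Complex.ofReal_pow, Real.sq_sqrt zero_le_two]; norm_num
    simp only [norm_inv, Real.norm_eq_abs, abs_of_nonneg (Real.sqrt_nonneg 2), Complex.ofReal_mul,
      Complex.ofReal_inv, mul_pow, inv_pow, this]
    ring
  rw [h, lintegral_map (by fun_prop) (by fun_prop)]
  have h2 : ∀ x : E, (ENNReal.ofReal (‖(√2)⁻¹ • x‖ ^ 2))⁻¹ =
      2 * (ENNReal.ofReal (‖x‖ ^ 2))⁻¹ := by
    intro x
    rw [norm_smul, mul_pow, norm_inv, Real.norm_eq_abs, inv_pow, sq_abs, Real.sq_sqrt zero_le_two,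
      ENNReal.ofReal_mul (by positivity), ENNReal.mul_inv (by simp) (by simp),
      ENNReal.ofReal_inv_of_pos two_pos, inv_inv]
    simp
  simp_rw [h2]
  rw [lintegral_const_mul _ (by fun_prop), lintegral_inv_norm_sq_stdGaussian he hE,
    show (2 : ENNReal) = ENNReal.ofReal 2 by simp, ← ENNReal.ofReal_mul zero_le_two]
  congr 1
  have he' : (e : ℝ) ≠ 0 := by exact_mod_cast he
  field_simp

end real

lemma measurePreserving_insertNth {V : Type*} [MeasurableSpace V] {μ : Measure V}
    [IsProbabilityMeasure μ] {p : ℕ} (j : Fin (p + 1)) :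
    MeasurePreserving (fun z : (Fin p → V) × V => (j.insertNth z.2 z.1 : Fin (p + 1) → V))
      ((Measure.pi fun _ => μ).prod μ) (Measure.pi fun _ => μ) :=
  ((measurePreserving_piFinSuccAbove (fun _ : Fin (p + 1) => μ) j).symm _).comp
    Measure.measurePreserving_swap

/-! ### Inverse Gram matrices of Gaussian vectors -/

section complex

variable {V : Type*} [NormedAddCommGroup V] [InnerProductSpace ℂ V]

lemma linearIndependent_insertNth_iff {p : ℕ} (j : Fin (p + 1)) (x : V) (v : Fin p → V) :
    LinearIndependent ℂ (j.insertNth x v : Fin (p + 1) → V) ↔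
      LinearIndependent ℂ v ∧ x ∉ Submodule.span ℂ (Set.range v) := by
  rw [← linearIndependent_equiv j.cycleRange.symm, Fin.insertNth_comp_cycleRange_symm]
  exact linearIndependent_finCons

lemma inv_gram_apply_self_eq_ofReal {p : ℕ} (v : Fin p → V) (j : Fin p) :
    (Matrix.gram ℂ v)⁻¹ j j = (((Matrix.gram ℂ v)⁻¹ j j).re : ℂ) := by
  have h := (Matrix.isHermitian_gram ℂ v).inv
  exact (Complex.conj_eq_iff_re.mp (h.apply j j)).symm

open scoped ComplexOrder in
lemma inv_gram_apply_self_re_nonneg {p : ℕ} (v : Fin p → V) (j : Fin p) :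
    0 ≤ ((Matrix.gram ℂ v)⁻¹ j j).re :=
  (Complex.nonneg_iff.mp ((Matrix.posSemidef_gram ℂ v).inv.diag_nonneg (i := j))).1

lemma measurable_inv_gram_apply [FiniteDimensional ℂ V] [MeasurableSpace V] [BorelSpace V] {p : ℕ} (i j : Fin p) :
    Measurable fun v : Fin p → V => (Matrix.gram ℂ v)⁻¹ i j := by
  have : ProperSpace V := FiniteDimensional.proper ℂ V
  have : SecondCountableTopology V := inferInstance
  have hc : Continuous fun v : Fin p → V => Matrix.gram ℂ v := by
    refine continuous_matrix fun i j => ?_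
    simp only [Matrix.gram_apply]
    fun_prop
  simp only [Matrix.inv_def, Matrix.smul_apply, Ring.inverse_eq_inv', smul_eq_mul]
  have h1 : Measurable fun v : Fin p → V => (Matrix.gram ℂ v).det := hc.matrix_det.measurable
  have h2 : Measurable fun v : Fin p → V => (Matrix.gram ℂ v).adjugate i j :=
    (hc.matrix_adjugate.matrix_elem i j).measurable
  exact h1.inv.mul h2

variable [FiniteDimensional ℂ V]

/-- Let `w` be the part of `x` orthogonal to the span of `v`. It is a combination of the vectors
with coefficient `1` at `j`. Pairing with each vector shows that the Gram matrix sends the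
coefficient vector to `‖w‖²` times the `j`-th unit vector; then invert. -/
lemma inv_gram_insertNth_apply {p : ℕ} (j : Fin (p + 1)) (x : V) (v : Fin p → V)
    (h : LinearIndependent ℂ (j.insertNth x v : Fin (p + 1) → V)) :
    (Matrix.gram ℂ (j.insertNth x v : Fin (p + 1) → V))⁻¹ j j =
      ((‖(Submodule.span ℂ (Set.range v))ᗮ.starProjection x‖ ^ 2 : ℝ) : ℂ)⁻¹ := by
  set K := Submodule.span ℂ (Set.range v) with hK
  set u : Fin (p + 1) → V := j.insertNth x v with hu
  set w := Kᗮ.starProjection x with hw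
  have hwx : K.starProjection x + w = x := K.starProjection_add_starProjection_orthogonal x
  obtain ⟨c, hc⟩ := (Submodule.mem_span_range_iff_exists_fun ℂ).mp
    (K.starProjection_apply_mem x)
  set a : Fin (p + 1) → ℂ := j.insertNth 1 (-c) with ha
  have hsum : ∑ i, a i • u i = w := by
    rw [Fin.sum_univ_succAbove _ j]
    simp only [ha, hu, Fin.insertNth_apply_same, Fin.insertNth_apply_succAbove, one_smul,
      Pi.neg_apply, neg_smul, Finset.sum_neg_distrib, hc]
    rw [eq_sub_of_add_eq' hwx]
    abel
  have hwK : w ∈ Kᗮ := Kᗮ.starProjection_apply_mem x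
  have hGa : Matrix.gram ℂ u *ᵥ a = ((‖w‖ ^ 2 : ℝ) : ℂ) • Pi.single j 1 := by
    ext i
    have h1 : (Matrix.gram ℂ u *ᵥ a) i = inner ℂ (u i) w := by
      rw [← hsum, inner_sum, Matrix.mulVec, dotProduct]
      refine Finset.sum_congr rfl fun l _ => ?_
      rw [Matrix.gram_apply, inner_smul_right, mul_comm]
    rw [h1]
    refine j.succAboveCases ?_ (fun l => ?_) i
    · have h2 : inner ℂ (K.starProjection x) w = 0 :=
        hwK _ (K.starProjection_apply_mem x)
      simp only [hu, Fin.insertNth_apply_same, Pi.smul_apply, Pi.single_eq_same, smul_eq_mul,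
        mul_one]
      conv_lhs => rw [← hwx, inner_add_left, h2, zero_add, inner_self_eq_norm_sq_to_K]
      simp
    · have h2 : inner ℂ (v l) w = 0 := hwK _ (Submodule.subset_span ⟨l, rfl⟩)
      simp [hu, h2]
  have hdet : IsUnit (Matrix.gram ℂ u).det :=
    isUnit_iff_ne_zero.mpr ((Matrix.det_gram_ne_zero_iff_linearIndependent).mpr h)
  have h3 := congrArg (fun y => ((Matrix.gram ℂ u)⁻¹ *ᵥ y) j) hGa
  simp only [Matrix.mulVec_mulVec, Matrix.nonsing_inv_mul _ hdet, Matrix.one_mulVec,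
    Matrix.mulVec_smul, Pi.smul_apply, Matrix.mulVec_single_one, Matrix.col_apply, smul_eq_mul]
    at h3
  rw [ha, Fin.insertNth_apply_same] at h3
  exact eq_inv_of_mul_eq_one_right h3.symm

variable [MeasurableSpace V] [BorelSpace V]

/-- A measure on a complex inner product space is standard complex Gaussian if its characteristic
function is `t ↦ exp (-‖t‖² / 4)`. -/
def IsStdComplexGaussian (μ : Measure V) : Prop :=
  ∀ t, ∫ x, Complex.exp (((inner ℂ x t : ℂ).re : ℂ) * Complex.I) ∂μ = Complex.exp (-‖t‖ ^ 2 / 4)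

variable {μ : Measure V} [IsProbabilityMeasure μ]

/-- For `t ∈ K`, pairing `t` with `x` or with its projection gives the same value, so the projection
is standard Gaussian on `K`, of real dimension `2 * (e + 1)`. -/
lemma IsStdComplexGaussian.lintegral_inv_norm_sq_starProjection (hμ : IsStdComplexGaussian μ)
    (K : Submodule ℂ V) {e : ℕ} (he : e ≠ 0) (hK : Module.finrank ℂ K = e + 1) :
    ∫⁻ x, (ENNReal.ofReal (‖K.starProjection x‖ ^ 2))⁻¹ ∂μ = ENNReal.ofReal (1 / e) := by
  let : InnerProductSpace ℝ K := InnerProductSpace.complexToReal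
  have : FiniteDimensional ℝ K := FiniteDimensional.complexToReal K
  have hm : Measurable fun x => K.orthogonalProjectionOnto x :=
    K.orthogonalProjectionOnto.continuous.measurable
  rw [← lintegral_inv_norm_sq_of_charFun (E := K) he
    (by rw [finrank_real_of_complex, hK]) (μ.map fun x => K.orthogonalProjectionOnto x)]
  · rw [lintegral_map (by fun_prop) hm]
    rfl
  · intro t
    rw [charFun_apply, integral_map hm.aemeasurable (by fun_prop)]
    rw [show ‖t‖ = ‖(t : V)‖ from rfl, ← hμ t]
    refine integral_congr_ae (Filter.Eventually.of_forall fun x => ?_)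
    simp only
    rw [real_inner_eq_re_inner ℂ, Submodule.coe_inner]
    congr 4
    exact congrArg Complex.re <| K.inner_orthogonalProjectionOnto_eq_of_mem_right t x

/-- The inverse squared distance to `K` has finite mean, so the distance is almost surely nonzero.
Codimension at least two is what makes that mean finite. -/
lemma IsStdComplexGaussian.ae_notMem (hμ : IsStdComplexGaussian μ) (K : Submodule ℂ V)
    (hK : Module.finrank ℂ K + 2 ≤ Module.finrank ℂ V) : ∀ᵐ x ∂μ, x ∉ K := by
  have hs := K.finrank_add_finrank_orthogonal
  obtain ⟨e, he⟩ : ∃ e, Module.finrank ℂ Kᗮ = e + 2 := ⟨Module.finrank ℂ Kᗮ - 2, by omega⟩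
  have h := hμ.lintegral_inv_norm_sq_starProjection Kᗮ (Nat.succ_ne_zero e) he
  have hfin := ae_lt_top (f := fun x => (ENNReal.ofReal (‖Kᗮ.starProjection x‖ ^ 2))⁻¹) (μ := μ)
    (by
      have := Kᗮ.starProjection.continuous.measurable
      fun_prop) (by rw [h]; exact ENNReal.ofReal_ne_top)
  filter_upwards [hfin] with x hx hxK
  have : Kᗮ.starProjection x = 0 := by
    rw [Submodule.starProjection_apply_eq_zero_iff]
    simpa using hxK
  simp [this] at hx

lemma measurableSet_linearIndependent (p : ℕ) :
    MeasurableSet {v : Fin p → V | LinearIndependent ℂ v} := by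
  have : ProperSpace V := FiniteDimensional.proper ℂ V
  have : SecondCountableTopology V := inferInstance
  exact isOpen_setOfPred_linearIndependent.measurableSet

lemma IsStdComplexGaussian.ae_linearIndependent (hμ : IsStdComplexGaussian μ) {p : ℕ}
    (hp : p < Module.finrank ℂ V) :
    ∀ᵐ v ∂Measure.pi (fun _ : Fin p => μ), LinearIndependent ℂ v := by
  induction p with
  | zero => exact Filter.Eventually.of_forall fun v => linearIndependent_empty_type
  | succ p ih =>
    have hmp := measurePreserving_insertNth (μ := μ) (0 : Fin (p + 1))
    have hset : MeasurableSet {z : (Fin p → V) × V |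
        LinearIndependent ℂ (Fin.insertNth 0 z.2 z.1 : Fin (p + 1) → V)} :=
      hmp.measurable (measurableSet_linearIndependent _)
    rw [← hmp.map_eq, ae_map_iff hmp.measurable.aemeasurable (measurableSet_linearIndependent _),
      Measure.ae_prod_iff_ae_ae hset]
    filter_upwards [ih (by omega)] with v hv
    filter_upwards [hμ.ae_notMem (Submodule.span ℂ (Set.range v))
      (by rw [finrank_span_eq_card hv, Fintype.card_fin]; omega)] with x hx
    exact (linearIndependent_insertNth_iff 0 x v).mpr ⟨hv, hx⟩

lemma IsStdComplexGaussian.lintegral_inv_gram (hμ : IsStdComplexGaussian μ) {p : ℕ}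
    (hp : p < Module.finrank ℂ V) (j : Fin p) :
    ∫⁻ v, ENNReal.ofReal ((Matrix.gram ℂ v)⁻¹ j j).re ∂Measure.pi (fun _ : Fin p => μ) =
      ENNReal.ofReal (1 / (Module.finrank ℂ V - p : ℝ)) := by
  obtain ⟨p, rfl⟩ : ∃ p', p = p' + 1 := ⟨p - 1, by have := j.2; omega⟩
  have hmeas : Measurable fun v : Fin (p + 1) → V =>
      ENNReal.ofReal ((Matrix.gram ℂ v)⁻¹ j j).re :=
    (Complex.measurable_re.comp (measurable_inv_gram_apply j j)).ennreal_ofReal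
  have hmp := measurePreserving_insertNth (μ := μ) j
  rw [← hmp.lintegral_comp hmeas, lintegral_prod
    (fun z : (Fin p → V) × V =>
      ENNReal.ofReal ((Matrix.gram ℂ (j.insertNth z.2 z.1 : Fin (p + 1) → V))⁻¹ j j).re)
    (hmeas.comp hmp.measurable).aemeasurable]
  -- The complement of the span of the other `p` vectors has dimension `e + 2`, giving mean `1 / (e
  -- + 1)`, and `e + 1` is the dimension of `V` minus the total number `p + 1` of vectors.
  obtain ⟨e, he⟩ : ∃ e, Module.finrank ℂ V = p + (e + 2) :=
    ⟨Module.finrank ℂ V - p - 2, by omega⟩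
  have key : ∀ᵐ v ∂Measure.pi (fun _ : Fin p => μ),
      ∫⁻ x, ENNReal.ofReal ((Matrix.gram ℂ (j.insertNth x v : Fin (p + 1) → V))⁻¹ j j).re ∂μ =
        ENNReal.ofReal (1 / (e + 1 : ℕ)) := by
    filter_upwards [hμ.ae_linearIndependent (p := p) (by omega)] with v hv
    set K := Submodule.span ℂ (Set.range v)
    have hK : Module.finrank ℂ K = p := by
      rw [finrank_span_eq_card hv, Fintype.card_fin]
    have hs := K.finrank_add_finrank_orthogonal
    rw [← hμ.lintegral_inv_norm_sq_starProjection Kᗮ (Nat.succ_ne_zero e) (by omega)]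
    refine lintegral_congr_ae ?_
    filter_upwards [hμ.ae_notMem K (by omega)] with x hx
    have hx0 : 0 < ‖Kᗮ.starProjection x‖ ^ 2 := by
      have : Kᗮ.starProjection x ≠ 0 := by
        rw [Ne, Submodule.starProjection_apply_eq_zero_iff]
        simpa using hx
      positivity
    rw [inv_gram_insertNth_apply j x v ((linearIndependent_insertNth_iff j x v).mpr ⟨hv, hx⟩),
      ← Complex.ofReal_inv, Complex.ofReal_re, ENNReal.ofReal_inv_of_pos hx0]
  rw [lintegral_congr_ae key, lintegral_const, measure_univ, mul_one, he]
  congr 2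
  push_cast
  ring

theorem IsStdComplexGaussian.integral_trace_inv_gram (hμ : IsStdComplexGaussian μ) {p : ℕ}
    (hp : p < Module.finrank ℂ V) :
    Integrable (fun v => (Matrix.gram ℂ v)⁻¹.trace) (Measure.pi fun _ : Fin p => μ) ∧
      ∫ v, (Matrix.gram ℂ v)⁻¹.trace ∂(Measure.pi fun _ : Fin p => μ) =
        ((p / (Module.finrank ℂ V - p) : ℝ) : ℂ) := by
  have hpos : (0 : ℝ) < Module.finrank ℂ V - p := by
    rw [sub_pos]; exact_mod_cast hp
  have hre : ∀ j : Fin p, Measurable fun v : Fin p → V => ((Matrix.gram ℂ v)⁻¹ j j).re :=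
    fun j => Complex.measurable_re.comp (measurable_inv_gram_apply j j)
  have hint : ∀ j : Fin p, Integrable (fun v : Fin p → V => ((Matrix.gram ℂ v)⁻¹ j j).re)
      (Measure.pi fun _ : Fin p => μ) := fun j =>
    ⟨(hre j).aestronglyMeasurable, by
      rw [hasFiniteIntegral_iff_ofReal
        (Filter.Eventually.of_forall fun v => inv_gram_apply_self_re_nonneg v j),
        hμ.lintegral_inv_gram hp j]
      exact ENNReal.ofReal_lt_top⟩
  have htr : ∀ v : Fin p → V, (Matrix.gram ℂ v)⁻¹.trace =
      ∑ j, (((Matrix.gram ℂ v)⁻¹ j j).re : ℂ) := fun v =>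
    Finset.sum_congr rfl fun j _ => inv_gram_apply_self_eq_ofReal v j
  simp_rw [htr]
  refine ⟨integrable_finsetSum _ fun j _ => (hint j).ofReal, ?_⟩
  rw [integral_finsetSum _ fun j _ => (hint j).ofReal]
  have hval : ∀ j : Fin p, ∫ v, (((Matrix.gram ℂ v)⁻¹ j j).re : ℂ)
      ∂(Measure.pi fun _ : Fin p => μ) = ((1 / (Module.finrank ℂ V - p : ℝ) : ℝ) : ℂ) := by
    intro j
    rw [integral_complex_ofReal, integral_eq_lintegral_of_nonneg_ae
      (Filter.Eventually.of_forall fun v => inv_gram_apply_self_re_nonneg v j)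
      (hre j).aestronglyMeasurable, hμ.lintegral_inv_gram hp j,
      ENNReal.toReal_ofReal (by positivity)]
  simp_rw [hval]
  rw [Finset.sum_const, Finset.card_univ, Fintype.card_fin, nsmul_eq_mul]
  push_cast
  ring

end complex

/-! ### From independent entries to Gaussian columns -/

lemma measurable_complex_mk : Measurable fun p : ℝ × ℝ => (⟨p.1, p.2⟩ : ℂ) :=
  Complex.measurableEquivRealProd.symm.measurable

instance : IsProbabilityMeasure stdComplexGaussian :=
  Measure.isProbabilityMeasure_map measurable_complex_mk.aemeasurable

lemma isStdComplexGaussian_stdComplexGaussian : IsStdComplexGaussian stdComplexGaussian := by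
  intro t
  have h : ∀ p : ℝ × ℝ, Complex.exp (((inner ℂ (⟨p.1, p.2⟩ : ℂ) t : ℂ).re : ℂ) * Complex.I) =
      Complex.exp (t.re * p.1 * Complex.I) * Complex.exp (t.im * p.2 * Complex.I) := by
    intro p
    rw [← Complex.exp_add, RCLike.inner_apply]
    congr 1
    simp only [Complex.mul_re, Complex.conj_re, Complex.conj_im]
    push_cast
    ring
  rw [stdComplexGaussian, integral_map measurable_complex_mk.aemeasurable
    (Measurable.aestronglyMeasurable (by fun_prop))]
  simp_rw [h]
  rw [integral_prod_mul (fun x : ℝ => Complex.exp (t.re * x * Complex.I))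
    (fun y : ℝ => Complex.exp (t.im * y * Complex.I)), ← charFun_apply_real,
    ← charFun_apply_real, charFun_gaussianReal, charFun_gaussianReal, ← Complex.exp_add]
  congr 1
  have hn : (‖t‖ : ℂ) ^ 2 = t.re * t.re + t.im * t.im := by
    rw [← Complex.ofReal_pow, Complex.sq_norm, Complex.normSq_apply]
    push_cast
    rfl
  rw [hn]
  push_cast
  ring

variable {κ : Type*} [Fintype κ]

variable (κ) in
/-- The law of a vector of independent circularly symmetric complex Gaussians of unit variance. -/
def stdComplexGaussianVec : Measure (EuclideanSpace ℂ κ) :=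
  (Measure.pi fun _ : κ => stdComplexGaussian).map (WithLp.toLp 2)

instance : IsProbabilityMeasure (stdComplexGaussianVec κ) :=
  Measure.isProbabilityMeasure_map (Measurable.aemeasurable (by fun_prop))

lemma isStdComplexGaussian_stdComplexGaussianVec :
    IsStdComplexGaussian (stdComplexGaussianVec κ) := by
  intro t
  have h : ∀ x : κ → ℂ, Complex.exp (((inner ℂ (WithLp.toLp 2 x) t : ℂ).re : ℂ) * Complex.I) =
      ∏ i, Complex.exp (((inner ℂ (x i) (t i) : ℂ).re : ℂ) * Complex.I) := by
    intro x
    rw [← Complex.exp_sum, ← Finset.sum_mul, PiLp.inner_apply, Complex.re_sum, Complex.ofReal_sum]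
  rw [stdComplexGaussianVec, integral_map (Measurable.aemeasurable (by fun_prop))
    (Measurable.aestronglyMeasurable (by fun_prop))]
  simp_rw [h]
  rw [integral_fintype_prod_eq_prod
    (f := fun i z => Complex.exp (((inner ℂ z (t i) : ℂ).re : ℂ) * Complex.I))]
  simp_rw [fun i => isStdComplexGaussian_stdComplexGaussian (t i)]
  rw [← Complex.exp_sum, ← Finset.sum_div, Finset.sum_neg_distrib, ← Complex.ofReal_pow,
    EuclideanSpace.norm_sq_eq]
  push_cast
  rfl

variable {Ω : Type*} [MeasurableSpace Ω] {P : Measure Ω} [IsProbabilityMeasure P] {p : ℕ}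

lemma hasLaw_columns {X : Ω → Matrix κ (Fin p) ℂ}
    (hX : ∀ i j, HasLaw (fun ω => X ω i j) stdComplexGaussian P)
    (hindep : iIndepFun (fun (z : κ × Fin p) ω => X ω z.1 z.2) P) :
    HasLaw (fun ω (j : Fin p) => (WithLp.toLp 2 fun i => X ω i j : EuclideanSpace ℂ κ))
      (Measure.pi fun _ => stdComplexGaussianVec κ) P := by
  have hm : ∀ z : Fin p × κ, AEMeasurable (fun ω => X ω z.2 z.1) P :=
    fun z => (hX z.2 z.1).aemeasurable
  have h1 : iIndepFun (fun (z : Fin p × κ) ω => X ω z.2 z.1) P :=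
    hindep.precomp (g := Prod.swap) Prod.swap_injective
  have h2 := (iIndepFun_iff_map_fun_eq_pi_map hm).mp h1
  simp_rw [fun z : Fin p × κ => (hX z.2 z.1).map_eq] at h2
  have hmeas : AEMeasurable (fun ω (z : Fin p × κ) => X ω z.2 z.1) P := aemeasurable_pi_lambda _ hm
  -- Currying groups the independent entries by column.
  have h3 : (Measure.pi fun _ : Fin p × κ => stdComplexGaussian).map
      (MeasurableEquiv.curry (Fin p) κ ℂ) =
        Measure.pi fun _ : Fin p => Measure.pi fun _ : κ => stdComplexGaussian := by
    have := Measure.infinitePi_map_curry (ι := Fin p) (κ := κ)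
      (fun _ _ => stdComplexGaussian)
    simpa only [Measure.infinitePi_eq_pi] using this
  have h4 : (Measure.pi fun _ : Fin p => Measure.pi fun _ : κ => stdComplexGaussian).map
      (fun x j => (WithLp.toLp 2 (x j) : EuclideanSpace ℂ κ)) =
        Measure.pi fun _ => stdComplexGaussianVec κ :=
    (measurePreserving_pi _ _ fun _ => ⟨by fun_prop, rfl⟩).map_eq
  have hm4 : Measurable fun (x : Fin p → κ → ℂ) (j : Fin p) =>
      (WithLp.toLp 2 (x j) : EuclideanSpace ℂ κ) := by fun_prop
  have hcomp : (fun ω (j : Fin p) => (WithLp.toLp 2 fun i => X ω i j : EuclideanSpace ℂ κ)) =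
      ((fun x j => WithLp.toLp 2 (x j)) ∘ MeasurableEquiv.curry (Fin p) κ ℂ) ∘
        fun ω (z : Fin p × κ) => X ω z.2 z.1 := rfl
  have hm5 := hm4.comp (MeasurableEquiv.curry (Fin p) κ ℂ).measurable
  refine ⟨hcomp ▸ hm5.comp_aemeasurable hmeas, ?_⟩
  rw [hcomp, ← AEMeasurable.map_map_of_aemeasurable hm5.aemeasurable hmeas, h2,
    ← Measure.map_map hm4 (MeasurableEquiv.curry (Fin p) κ ℂ).measurable, h3, h4]

lemma gram_columns (X : Matrix κ (Fin p) ℂ) :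
    Matrix.gram ℂ (fun j => (WithLp.toLp 2 fun i => X i j : EuclideanSpace ℂ κ)) = Xᴴ * X := by
  ext i j
  rw [Matrix.gram_apply, PiLp.inner_apply, Matrix.mul_apply]
  refine Finset.sum_congr rfl fun l _ => ?_
  rw [RCLike.inner_apply, Matrix.conjTranspose_apply, mul_comm]
  rfl

open scoped ComplexOrder in
theorem integral_invTrace_conjTranspose_mul_self {X : Ω → Matrix κ (Fin p) ℂ}
    (hX : ∀ i j, HasLaw (fun ω => X ω i j) stdComplexGaussian P)
    (hindep : iIndepFun (fun (z : κ × Fin p) ω => X ω z.1 z.2) P) (hp : p < Fintype.card κ) :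
    Integrable (fun ω => invTrace ((X ω)ᴴ * X ω)) P ∧
      ∫ ω, invTrace ((X ω)ᴴ * X ω) ∂P = ((p / (Fintype.card κ - p) : ℝ) : ℂ) := by
  have hlaw := hasLaw_columns hX hindep
  have hfr : Module.finrank ℂ (EuclideanSpace ℂ κ) = Fintype.card κ := finrank_euclideanSpace
  have hG := isStdComplexGaussian_stdComplexGaussianVec (κ := κ)
  have hae : (fun ω => invTrace ((X ω)ᴴ * X ω)) =ᵐ[P] fun ω =>
      (Matrix.gram ℂ fun j => (WithLp.toLp 2 fun i => X ω i j : EuclideanSpace ℂ κ))⁻¹.trace := by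
    have h1 : ∀ᵐ ω ∂P, LinearIndependent ℂ
        fun j => (WithLp.toLp 2 fun i => X ω i j : EuclideanSpace ℂ κ) := by
      refine ae_of_ae_map (p := fun v => LinearIndependent ℂ v) hlaw.aemeasurable ?_
      rw [hlaw.map_eq]
      exact hG.ae_linearIndependent (hfr ▸ hp)
    filter_upwards [h1] with ω hω
    have hdet := Matrix.det_gram_ne_zero_iff_linearIndependent.mpr hω
    rw [gram_columns] at hdet ⊢
    rw [trace_inv_conjTranspose_mul_self]
    rw [← Matrix.rank_conjTranspose_mul_self, Matrix.rank_of_isUnit _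
      ((Matrix.isUnit_iff_isUnit_det _).mpr hdet.isUnit), Fintype.card_fin]
  obtain ⟨hi, hv⟩ := hG.integral_trace_inv_gram (hfr ▸ hp)
  rw [hfr] at hv
  rw [integral_congr_ae hae, integrable_congr hae]
  rw [← hlaw.map_eq] at hi hv
  rw [integral_map hlaw.aemeasurable hi.aestronglyMeasurable] at hv
  exact ⟨hi.comp_aemeasurable hlaw.aemeasurable, hv⟩

/-- Passing to the plain transpose keeps every entry unchanged, so laws and independence carry over
without using invariance under conjugation. -/
theorem integral_invTrace_self_mul_conjTranspose {ι : Type*} [Fintype ι] [DecidableEq κ]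
    {X : Ω → Matrix ι κ ℂ}
    (hX : ∀ i j, HasLaw (fun ω => X ω i j) stdComplexGaussian P)
    (hindep : iIndepFun (fun (z : ι × κ) ω => X ω z.1 z.2) P)
    (hlt : Fintype.card ι < Fintype.card κ) :
    Integrable (fun ω => invTrace ((X ω)ᴴ * X ω)) P ∧
      ∫ ω, invTrace ((X ω)ᴴ * X ω) ∂P =
        ((Fintype.card ι / (Fintype.card κ - Fintype.card ι) : ℝ) : ℂ) := by
  let e := Fintype.equivFin ι
  have key : ∀ M : Matrix ι κ ℂ, invTrace (Mᴴ * M) =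
      invTrace ((Mᵀ.submatrix id e.symm)ᴴ * Mᵀ.submatrix id e.symm) := by
    intro M
    set N : Matrix κ (Fin (Fintype.card ι)) ℂ := Mᵀ.submatrix id e.symm with hN
    have h1 : Mᴴ * M = (Nᵀ)ᴴ * Nᵀ := by
      ext i j
      simp only [Matrix.mul_apply, Matrix.conjTranspose_apply, Matrix.transpose_apply, hN,
        Matrix.submatrix_apply, id]
      exact (e.symm.sum_comp fun l => star (M l i) * M l j).symm
    rw [h1, invTrace_mul_comm, ← invTrace_transpose, Matrix.transpose_mul]
    rfl
  simp_rw [key]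
  refine integral_invTrace_conjTranspose_mul_self (fun i j => hX (e.symm j) i) ?_ hlt
  exact hindep.precomp (g := fun z : κ × Fin (Fintype.card ι) => (e.symm z.2, z.1))
    fun a b hab => by
      simp only [Prod.mk.injEq, e.symm.injective.eq_iff] at hab
      exact Prod.ext hab.2 hab.1

end GSVD

end

/-! ### The expectation of the trace -/

theorem corollary2 {Ω : Type*} [MeasurableSpace Ω] (P : MeasureTheory.Measure Ω)
    [MeasureTheory.IsProbabilityMeasure P] (m n q : ℕ) (hmqn : m + q ≠ n)
    (A : Ω → Matrix (Fin m) (Fin n) ℂ) (C : Ω → Matrix (Fin q) (Fin n) ℂ)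
    (hA : ∀ i j, ProbabilityTheory.HasLaw (fun ω => A ω i j) GSVD.stdComplexGaussian P)
    (hC : ∀ i j, ProbabilityTheory.HasLaw (fun ω => C ω i j) GSVD.stdComplexGaussian P)
    (hindep : ProbabilityTheory.iIndepFun
      (fun (p : (Fin m ⊕ Fin q) × Fin n) ω => Matrix.fromRows (A ω) (C ω) p.1 p.2) P) :
    (∀ᵐ ω ∂P, ∃ Q, GSVD.IsGSVDFactor (A ω) (C ω) Q) ∧
    ∀ Q : Ω → Matrix (Fin n) (Fin n) ℂ,
      (∀ᵐ ω ∂P, GSVD.IsGSVDFactor (A ω) (C ω) (Q ω)) →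
        MeasureTheory.Integrable (fun ω => (Q ω * (Q ω)ᴴ).trace) P ∧
        ∫ ω, (Q ω * (Q ω)ᴴ).trace ∂P =
          (((min (m + q) n : ℕ) : ℝ) / |(m : ℝ) + (q : ℝ) - (n : ℝ)| : ℝ) := by
  refine ⟨Filter.Eventually.of_forall fun ω => GSVD.exists_gsvd _ _, fun Q hQ => ?_⟩
  -- The right side involves only `B`, so an arbitrary, possibly nonmeasurable choice of `Q` is
  -- allowed.
  have hae : (fun ω => (Q ω * (Q ω)ᴴ).trace) =ᵐ[P] fun ω =>
      GSVD.invTrace ((Matrix.fromRows (A ω) (C ω))ᴴ * Matrix.fromRows (A ω) (C ω)) := by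
    filter_upwards [hQ] with ω hω using GSVD.trace_mul_conjTranspose_of_isGSVDFactor hω
  have hB : ∀ i j, ProbabilityTheory.HasLaw (fun ω => Matrix.fromRows (A ω) (C ω) i j)
      GSVD.stdComplexGaussian P := by
    rintro (i | i) j
    · exact hA i j
    · exact hC i j
  rw [MeasureTheory.integral_congr_ae hae, MeasureTheory.integrable_congr hae]
  rcases lt_or_gt_of_ne hmqn with h | h
  · have := GSVD.integral_invTrace_self_mul_conjTranspose hB hindep (by simpa using h)
    have h' : ((m : ℝ) + q) - n < 0 := by rw [sub_neg]; exact_mod_cast h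
    rw [min_eq_left h.le, abs_of_neg h', neg_sub]
    simpa using this
  · have := GSVD.integral_invTrace_conjTranspose_mul_self hB hindep (by simpa using h)
    have h' : 0 < ((m : ℝ) + q) - n := by rw [sub_pos]; exact_mod_cast h
    rw [min_eq_right h.le, abs_of_pos h']
    simpa using this
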